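/- For a nonempty integer partition $\pi$ let $s(\pi)$ denote its smallest part, and for $l\ge 1$ let $\delta_l$ be the triangular partition $(l-1,l-2,\dots,1)$ (empty for $l=1$). For an integer $n\ge 0$ consider all pairs $(\pi,\delta_{s(\pi)})$ of total size $n$, i.e. all nonempty partitions $\pi$ with $|\pi|+\binom{s(\pi)}{2}=n$, such that no odd part of $\pi$ is greater than $2s(\pi)$. Let $spt_o^{-}(n)$ be the sum, over all these pairs, of the number of times the smallest part $s(\pi)$ occurs in $\pi$ (so $spt_o^{-}(0)=0$). Then, for every integer $n\ge 0$, $$spt_o^{-}(2n)\equiv 0 \pmod 2 .$$ -/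

import Mathlib

/-- The smallest part `s(π)` of a partition `π` (with the value `0` for the empty partition). -/
def smallestPart {m : ℕ} (π : m.Partition) : ℕ :=
  π.parts.toFinset.min.untopD 0

/-- The parts of the triangular partition `δ_l = (l - 1, l - 2, …, 1)`. -/
def triangularParts (l : ℕ) : Multiset ℕ :=
  (Finset.Ico 1 l).val

/-- Odd parts greater than `2 s(π)` do not occur in `π`. -/
def NoLargeOddParts {m : ℕ} (π : m.Partition) : Prop :=
  ∀ a ∈ π.parts, Odd a → a ≤ 2 * smallestPart π

instance {m : ℕ} (π : m.Partition) : Decidable (NoLargeOddParts π) :=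
  inferInstanceAs (Decidable (∀ a ∈ π.parts, Odd a → a ≤ 2 * smallestPart π))

/-- `spt_o⁻(n)`: the total number of occurrences of the smallest part `s(π)` in `π`, over all
partition pairs `(π, δ)` of `n` (that is, `|π| + |δ| = n`) in which `δ = δ_{s(π)}` and odd parts
greater than `2 s(π)` do not occur in `π`. The empty `π` has no parts and contributes `0`. -/
def sptOMinus (n : ℕ) : ℕ :=
  ∑ p ∈ Finset.HasAntidiagonal.antidiagonal n,
    ∑ σ : p.1.Partition × p.2.Partition with
        σ.2.parts = triangularParts (smallestPart σ.1) ∧ NoLargeOddParts σ.1,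
      σ.1.parts.count (smallestPart σ.1)

/-! Sorting the pairs by `s = s(π)`, the generating function is `∑ q^(s choose 2) q^s / (1 - q^s)²`
times `∏ 1/(1 - q^i)` over `s < i ≤ 2s` and `∏ 1/(1 - q^(2j))` over `j > s`. This equals `1/(q²;
q²)_∞ · ∑ q^s (q; q)_{s-1}² β_s`, with `β_s` as in `baileyBeta`.

The sequence `β` belongs to a Bailey pair relative to 1 (`baileyBeta_eq`), so a limiting Bailey
lemma (`sum_baileyBeta`) turns the last sum into `∑ q^n/(1-q^n)² + ∑ (-1)^r q^(r(r-1)) (1+q^(2r))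
q^(2r)/(1-q^(2r))²`. Modulo 2 this is `∑ q^n/(1-q^(2n)) + ∑ q^(r(r+1))/(1-q^(2r))`. For even `k`,
both sums have as coefficient of `q^k` the number of factorizations of `k` into factors of opposite
parity, so the even coefficients cancel. The prefactor is a series in `q²` and preserves this.

All infinite sums and products are truncated, at a level harmless for the coefficient in question.
-/

/-- The `q`-Pochhammer symbol `(q; q)_n = (1 - q)(1 - q²)⋯(1 - qⁿ)`. -/
def qPoch {R : Type*} [CommRing R] (q : R) (n : ℕ) : R :=
  ∏ k ∈ Finset.range n, (1 - q ^ (k + 1))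

theorem qPoch_succ {R : Type*} [CommRing R] (q : R) (n : ℕ) :
    qPoch q (n + 1) = qPoch q n * (1 - q ^ (n + 1)) :=
  Finset.prod_range_succ _ _

/-- The reciprocal `1 / (q; q)_k`, extended by `0` to negative `k`. -/
def qPochInv {K : Type*} [CommRing K] [Inv K] (q : K) (k : ℤ) : K :=
  if 0 ≤ k then (qPoch q k.toNat)⁻¹ else 0

theorem qPochInv_natCast {K : Type*} [CommRing K] [Inv K] (q : K) (n : ℕ) :
    qPochInv q (n : ℤ) = (qPoch q n)⁻¹ := by
  simp [qPochInv]

theorem qPochInv_of_neg {K : Type*} [CommRing K] [Inv K] (q : K) {k : ℤ} (hk : k < 0) :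
    qPochInv q k = 0 := by
  simp [qPochInv, hk]

/-! ### The Bailey pair and a finite Bailey lemma -/

section Field

variable {K : Type*} [Field K] {q : K}

theorem qPoch_ne_zero (hq : ∀ k : ℕ, 1 - q ^ (k + 1) ≠ 0) (n : ℕ) : qPoch q n ≠ 0 :=
  Finset.prod_ne_zero_iff.2 fun k _ => hq k

/-- Extension by zero makes the recurrence valid for every integer: at `k = 0` the factor `1 - q^0`
vanishes. -/
theorem qPochInv_sub_one (hq : ∀ k : ℕ, 1 - q ^ (k + 1) ≠ 0) (k : ℤ) :
    qPochInv q (k - 1) = (1 - q ^ k) * qPochInv q k := by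
  rcases lt_trichotomy k 0 with h | rfl | h
  · rw [qPochInv_of_neg q h, qPochInv_of_neg q (by lia), mul_zero]
  · rw [qPochInv_of_neg q (by lia)]
    simp
  · obtain ⟨n, rfl⟩ : ∃ n : ℕ, k = (n : ℤ) + 1 := ⟨(k - 1).toNat, by lia⟩
    have h1 := hq n
    have h2 := qPoch_ne_zero hq n
    rw [add_sub_cancel_right, qPochInv_natCast, ← Nat.cast_succ, qPochInv_natCast, zpow_natCast,
      Nat.succ_eq_add_one, qPoch_succ]
    field_simp

/-- The telescoping of the summands of the Bailey pair `baileyBeta_eq` under its recurrence. -/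
theorem bailey_summand_telescope (hq0 : q ≠ 0) (hq : ∀ k : ℕ, 1 - q ^ (k + 1) ≠ 0) (n r : ℤ) :
    (1 + q ^ (2 * r)) * ((1 - q ^ n) * (1 - q ^ (2 * n - 1)) *
        (qPochInv q (n - 2 * r) * qPochInv q (n + 2 * r)) -
      q ^ (n - 1) * (qPochInv q (n - 1 - 2 * r) * qPochInv q (n - 1 + 2 * r))) =
    q ^ (2 * r) * (qPochInv q (n - 2 * (r + 1)) * qPochInv q (n + 2 * r)) +
      qPochInv q (n - 2 * r) * qPochInv q (n + 2 * (r - 1)) := by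
  have e1 : qPochInv q (n - 1 - 2 * r) = (1 - q ^ (n - 2 * r)) * qPochInv q (n - 2 * r) := by
    rw [← qPochInv_sub_one hq]; congr 1; ring
  have e2 : qPochInv q (n - 1 + 2 * r) = (1 - q ^ (n + 2 * r)) * qPochInv q (n + 2 * r) := by
    rw [← qPochInv_sub_one hq]; congr 1; ring
  have e3 : qPochInv q (n - 2 * (r + 1)) = (1 - q ^ (n - 1 - 2 * r)) *
      qPochInv q (n - 1 - 2 * r) := by
    rw [← qPochInv_sub_one hq]; congr 1; ring
  have e4 : qPochInv q (n + 2 * (r - 1)) = (1 - q ^ (n - 1 + 2 * r)) *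
      qPochInv q (n - 1 + 2 * r) := by
    rw [← qPochInv_sub_one hq]; congr 1; ring
  -- Every term is now a multiple of `1/(q; q)_{n-2r} · 1/(q; q)_{n+2r}`, leaving a rational
  -- identity in `q`, `q^r` and `q^n`.
  rw [e3, e4, e1, e2]
  generalize qPochInv q (n - 2 * r) = a
  generalize qPochInv q (n + 2 * r) = b
  have hx : q ^ r ≠ 0 := zpow_ne_zero _ hq0
  have f0 : q ^ (2 * r) = q ^ r * q ^ r := by rw [← zpow_add₀ hq0]; congr 1; ring
  have f1 : q ^ (n - 1) = q ^ n / q := by rw [zpow_sub₀ hq0, zpow_one]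
  have f2 : q ^ (2 * n - 1) = q ^ n * q ^ n / q := by
    rw [zpow_sub₀ hq0, zpow_one, ← zpow_add₀ hq0]; congr 2; ring
  rw [zpow_sub₀ hq0 n (2 * r), zpow_add₀ hq0 n (2 * r), zpow_sub₀ hq0 (n - 1) (2 * r),
    zpow_add₀ hq0 (n - 1) (2 * r), f1, f2, f0]
  generalize q ^ r = x at *
  generalize q ^ n = y at *
  field_simp
  ring

/-- The sequence `βₙ = q^{n(n-1)/2} (q²; q²)ₙ / ((q; q)ₙ (q; q)₂ₙ)`. -/
def baileyBeta (q : K) (n : ℕ) : K :=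
  q ^ n.choose 2 * qPoch (q ^ 2) n / (qPoch q n * qPoch q (2 * n))

/-- The coefficients `(-1)ʳ q^{r(r-1)} (1 + q^{2r})` with `r` shifted by one. -/
def baileyAlpha {R : Type*} [CommRing R] (q : R) (r : ℕ) : R :=
  (-1) ^ (r + 1) * q ^ (r * (r + 1)) * (1 + q ^ (2 * (r + 1)))

theorem baileyBeta_succ (hq : ∀ k : ℕ, 1 - q ^ (k + 1) ≠ 0) (n : ℕ) :
    (1 - q ^ (n + 1)) * (1 - q ^ (2 * n + 1)) * baileyBeta q (n + 1) = q ^ n * baileyBeta q n := by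
  have h1 := hq n
  have h2 := hq (2 * n)
  have h3 := hq (2 * n + 1)
  have h4 := qPoch_ne_zero hq n
  have h5 := qPoch_ne_zero hq (2 * n)
  rw [baileyBeta, baileyBeta, show 2 * (n + 1) = 2 * n + 1 + 1 by ring, qPoch_succ, qPoch_succ,
    qPoch_succ, qPoch_succ, Nat.choose_succ_succ' n 1, Nat.choose_one_right, ← pow_mul,
    show 2 * (n + 1) = 2 * n + 1 + 1 by ring, pow_add q n (n.choose (1 + 1))]
  generalize 1 - q ^ (n + 1) = a at *
  generalize 1 - q ^ (2 * n + 1) = b at *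
  generalize 1 - q ^ (2 * n + 1 + 1) = c at *
  field_simp

/-- The truncated Bailey sum satisfies the recurrence of `baileyBeta_succ` up to a boundary term. In
`bailey_summand_telescope` at `r = R + 1`, one summand cancels the old boundary term and the other
is the new one. -/
theorem baileySum_succ (hq0 : q ≠ 0) (hq : ∀ k : ℕ, 1 - q ^ (k + 1) ≠ 0) (n : ℤ) (R : ℕ) :
    (1 - q ^ n) * (1 - q ^ (2 * n - 1)) * (qPochInv q n * qPochInv q n +
      ∑ r ∈ Finset.range R, baileyAlpha q r *
        (qPochInv q (n - 2 * (r + 1)) * qPochInv q (n + 2 * (r + 1)))) -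
    q ^ (n - 1) * (qPochInv q (n - 1) * qPochInv q (n - 1) +
      ∑ r ∈ Finset.range R, baileyAlpha q r *
        (qPochInv q (n - 1 - 2 * (r + 1)) * qPochInv q (n - 1 + 2 * (r + 1)))) =
    (-1) ^ R * q ^ (R * (R + 1)) * (qPochInv q (n - 2 * (R + 1)) * qPochInv q (n + 2 * R)) := by
  induction R with
  | zero =>
    have h := qPochInv_sub_one hq n
    have h' := qPochInv_sub_one hq (n - 1)
    have f1 : q ^ (n - 1) = q ^ n / q := by rw [zpow_sub₀ hq0, zpow_one]
    have f2 : q ^ (2 * n - 1) = q ^ n * q ^ n / q := by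
      rw [zpow_sub₀ hq0, zpow_one, ← zpow_add₀ hq0]; congr 2; ring
    have e : n - 2 * (((0 : ℕ) : ℤ) + 1) = n - 1 - 1 := by push_cast; ring
    rw [e, h', h, f1, f2]
    simp only [Finset.range_zero, Finset.sum_empty, Nat.cast_zero, mul_zero, add_zero, zero_mul,
      pow_zero]
    field_simp
    ring
  | succ R ih =>
    have key := bailey_summand_telescope hq0 hq n (R + 1)
    rw [Finset.sum_range_succ, Finset.sum_range_succ]
    have e1 : (R : ℤ) + 1 - 1 = R := by ring
    rw [e1] at key
    have e2 : q ^ (2 * ((R : ℤ) + 1)) = q ^ (2 * (R + 1)) := by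
      rw [← zpow_natCast]; push_cast; rfl
    rw [e2] at key
    have e3 : (R + 1) * (R + 1 + 1) = R * (R + 1) + 2 * (R + 1) := by ring
    rw [e3, pow_add q]
    push_cast
    rw [baileyAlpha]
    linear_combination ih + (-1) ^ (R + 1) * q ^ (R * (R + 1)) * key

/-- The Bailey pair relative to `1` with `α_{2r+1} = 0` and `α_{2r} = (-1)ʳ q^{r(r-1)} (1 + q^{2r})`. -/
theorem baileyBeta_eq (hq0 : q ≠ 0) (hq : ∀ k : ℕ, 1 - q ^ (k + 1) ≠ 0) {n R : ℕ} (hR : n ≤ R) :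
    baileyBeta q n = qPochInv q n * qPochInv q n + ∑ r ∈ Finset.range R, baileyAlpha q r *
        (qPochInv q (n - 2 * (r + 1)) * qPochInv q (n + 2 * (r + 1))) := by
  induction n with
  | zero =>
    rw [Finset.sum_eq_zero]
    · simp [baileyBeta, qPochInv, qPoch]
    · intro r _
      rw [qPochInv_of_neg q (by push_cast; lia)]
      ring
  | succ n ih =>
    have h1 := hq n
    have h2 := hq (2 * n)
    have h := baileySum_succ hq0 hq ((n + 1 : ℕ) : ℤ) R
    -- The boundary term vanishes since `n + 1 ≤ R`, so both sides obey the same first-order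
    -- recurrence.
    rw [qPochInv_of_neg q (show ((n + 1 : ℕ) : ℤ) - 2 * (R + 1) < 0 by push_cast; lia)] at h
    have e1 : ((n + 1 : ℕ) : ℤ) - 1 = n := by push_cast; ring
    have e2 : 2 * ((n + 1 : ℕ) : ℤ) - 1 = ((2 * n + 1 : ℕ) : ℤ) := by push_cast; ring
    rw [e1, e2, ← ih (by lia), zpow_natCast, zpow_natCast, zpow_natCast] at h
    have h3 := baileyBeta_succ hq n
    refine mul_left_cancel₀ (mul_ne_zero h1 h2) ?_
    linear_combination h3 - h

/-- The sum telescopes: with `x = q^(r+1)` and `y = q^(N+1)`, `(1-y)² - (1-y/x)(1-xy) = y(1-x)²/x`.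
-/
theorem sum_qPoch_sq_mul (hq0 : q ≠ 0) (hq : ∀ k : ℕ, 1 - q ^ (k + 1) ≠ 0) (r N : ℕ) :
    ∑ n ∈ Finset.range N, q ^ (n + 1) * qPoch q n ^ 2 *
      (qPochInv q ((n + 1 : ℕ) - (r + 1)) * qPochInv q ((n + 1 : ℕ) + (r + 1))) =
    q ^ (r + 1) / (1 - q ^ (r + 1)) ^ 2 *
      (qPoch q N ^ 2 * (qPochInv q (N - (r + 1)) * qPochInv q (N + (r + 1)))) := by
  induction N with
  | zero =>
    rw [qPochInv_of_neg q (show ((0 : ℕ) : ℤ) - (r + 1) < 0 by push_cast; lia)]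
    simp
  | succ N ih =>
    rw [Finset.sum_range_succ, ih, qPoch_succ]
    have e1 : qPochInv q ((N : ℤ) - (r + 1)) = (1 - q ^ (((N + 1 : ℕ) : ℤ) - (r + 1))) *
        qPochInv q (((N + 1 : ℕ) : ℤ) - (r + 1)) := by
      rw [← qPochInv_sub_one hq]; congr 1; push_cast; ring
    have e2 : qPochInv q ((N : ℤ) + (r + 1)) = (1 - q ^ (((N + 1 : ℕ) : ℤ) + (r + 1))) *
        qPochInv q (((N + 1 : ℕ) : ℤ) + (r + 1)) := by
      rw [← qPochInv_sub_one hq]; congr 1; push_cast; ring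
    rw [e1, e2]
    generalize qPochInv q (((N + 1 : ℕ) : ℤ) - (r + 1)) = a
    generalize qPochInv q (((N + 1 : ℕ) : ℤ) + (r + 1)) = b
    have hr := hq r
    have hr0 : q ^ (r + 1) ≠ 0 := pow_ne_zero _ hq0
    have e3 : (r : ℤ) + 1 = ((r + 1 : ℕ) : ℤ) := by push_cast; ring
    rw [e3, zpow_sub₀ hq0, zpow_add₀ hq0, zpow_natCast, zpow_natCast]
    generalize q ^ (r + 1) = x at *
    generalize q ^ (N + 1) = y at *
    generalize qPoch q N = p
    field_simp
    ring

theorem sum_baileyBeta (hq0 : q ≠ 0) (hq : ∀ k : ℕ, 1 - q ^ (k + 1) ≠ 0) (N : ℕ) :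
    ∑ n ∈ Finset.range N, q ^ (n + 1) * qPoch q n ^ 2 * baileyBeta q (n + 1) =
    ∑ n ∈ Finset.range N, q ^ (n + 1) / (1 - q ^ (n + 1)) ^ 2 +
    ∑ r ∈ Finset.range N, baileyAlpha q r * (q ^ (2 * (r + 1)) / (1 - q ^ (2 * (r + 1))) ^ 2 *
      (qPoch q N ^ 2 * (qPochInv q (N - 2 * (r + 1)) * qPochInv q (N + 2 * (r + 1))))) := by
  have h1 : ∀ n ∈ Finset.range N, q ^ (n + 1) * qPoch q n ^ 2 * baileyBeta q (n + 1) =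
      q ^ (n + 1) / (1 - q ^ (n + 1)) ^ 2 + ∑ r ∈ Finset.range N, baileyAlpha q r *
        (q ^ (n + 1) * qPoch q n ^ 2 * (qPochInv q ((n + 1 : ℕ) - 2 * (r + 1)) *
          qPochInv q ((n + 1 : ℕ) + 2 * (r + 1)))) := by
    intro n hn
    rw [baileyBeta_eq hq0 hq (Finset.mem_range.1 hn), mul_add, Finset.mul_sum]
    congr 1
    · have h2 := hq n
      have h3 := qPoch_ne_zero hq n
      rw [qPochInv_natCast, qPoch_succ]
      field_simp
    · exact Finset.sum_congr rfl fun r _ => by ring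
  rw [Finset.sum_congr rfl h1, Finset.sum_add_distrib, Finset.sum_comm]
  congr 1
  refine Finset.sum_congr rfl fun r _ => ?_
  rw [← Finset.mul_sum]
  have h := sum_qPoch_sq_mul hq0 hq (2 * r + 1) N
  have e : (((2 * r + 1 : ℕ) : ℤ) + 1) = 2 * (r + 1) := by push_cast; ring
  rw [e, show 2 * r + 1 + 1 = 2 * (r + 1) by ring] at h
  rw [h]

end Field

/-! ### Transfer to formal power series and truncation -/

section PowerSeries

open PowerSeries

theorem coeff_inv_one_sub_X_pow {F : Type*} [Field F] {b : ℕ} (hb : b ≠ 0) (k : ℕ) :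
    coeff k ((1 - X ^ b : F⟦X⟧)⁻¹) = if b ∣ k then 1 else 0 := by
  have h : (1 - X ^ b : F⟦X⟧)⁻¹ = PowerSeries.mk fun k => if b ∣ k then 1 else 0 := by
    rw [eq_comm, PowerSeries.eq_inv_iff_mul_eq_one (by simp [hb])]
    ext k
    rw [mul_sub, mul_one, map_sub, coeff_mul_X_pow', coeff_mk, coeff_one]
    by_cases hk : b ≤ k
    · have h1 : b ∣ k - b ↔ b ∣ k := Nat.dvd_sub_iff_left hk dvd_rfl
      rw [if_pos hk, coeff_mk, if_neg (show ¬k = 0 by lia)]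
      simp [h1]
    · rw [if_neg hk, sub_zero]
      by_cases h0 : k = 0
      · simp [h0]
      · rw [if_neg h0, if_neg fun h => hk (Nat.le_of_dvd (by lia) h)]
  rw [h, coeff_mk]

theorem constantCoeff_qPoch {F : Type*} [Field F] {a : ℕ} (ha : a ≠ 0) (n : ℕ) :
    constantCoeff (qPoch (X ^ a : F⟦X⟧) n) = 1 := by
  simp [qPoch, map_prod, ha]

theorem constantCoeff_qPoch_X {F : Type*} [Field F] (n : ℕ) :
    constantCoeff (qPoch (X : F⟦X⟧) n) = 1 := by
  simpa using constantCoeff_qPoch (F := F) one_ne_zero n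

theorem map_powerSeries_inv {F K : Type*} [Field F] [Field K] (φ : F⟦X⟧ →+* K) {a : F⟦X⟧}
    (ha : constantCoeff a ≠ 0) : φ a⁻¹ = (φ a)⁻¹ := by
  apply eq_inv_of_mul_eq_one_left
  rw [← map_mul, PowerSeries.inv_mul_cancel _ ha, map_one]

theorem map_qPoch {R S : Type*} [CommRing R] [CommRing S] (φ : R →+* S) (q : R) (n : ℕ) :
    φ (qPoch q n) = qPoch (φ q) n := by
  simp [qPoch, map_prod]

theorem map_qPochInv_X {F K : Type*} [Field F] [Field K] (φ : F⟦X⟧ →+* K) (k : ℤ) :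
    φ (qPochInv X k) = qPochInv (φ X) k := by
  unfold qPochInv
  split_ifs
  · rw [map_powerSeries_inv _ (by simp [constantCoeff_qPoch_X]), map_qPoch]
  · exact map_zero φ

/-- The summand `q^{(n+1)(n+2)/2} (q²; q²)_{n+1} (q; q)_n² / ((q; q)_{n+1} (q; q)_{2n+2})`. -/
noncomputable def baileyTerm (F : Type*) [Field F] (n : ℕ) : F⟦X⟧ :=
  X ^ (n + 1) * qPoch X n ^ 2 * (X ^ (n + 1).choose 2 * qPoch (X ^ 2) (n + 1) *
    (qPoch X (n + 1) * qPoch X (2 * (n + 1)))⁻¹)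

theorem sum_baileyTerm (F : Type*) [Field F] (N : ℕ) :
    ∑ n ∈ Finset.range N, baileyTerm F n =
    ∑ n ∈ Finset.range N, X ^ (n + 1) * ((1 - X ^ (n + 1)) ^ 2)⁻¹ +
    ∑ r ∈ Finset.range N, baileyAlpha X r * (X ^ (2 * (r + 1)) * ((1 - X ^ (2 * (r + 1))) ^ 2)⁻¹ *
      (qPoch X N ^ 2 * (qPochInv X (N - 2 * (r + 1)) * qPochInv X (N + 2 * (r + 1))))) := by
  -- The Bailey identities need a field in which `q` is invertible; Laurent series provide one.
  let φ := HahnSeries.ofPowerSeries ℤ F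
  have hφ : Function.Injective φ := HahnSeries.ofPowerSeries_injective
  apply hφ
  have hX : φ X ≠ 0 := by
    rw [Ne, map_eq_zero_iff φ hφ]
    exact X_ne_zero
  have hq : ∀ k : ℕ, 1 - φ X ^ (k + 1) ≠ 0 := by
    intro k
    rw [← map_pow, ← map_one φ, ← map_sub, Ne, map_eq_zero_iff φ hφ]
    intro h
    simpa using congrArg constantCoeff h
  have hinv : ∀ k : ℕ, φ ((1 - X ^ (k + 1)) ^ 2)⁻¹ = ((1 - φ X ^ (k + 1)) ^ 2)⁻¹ := by
    intro k
    rw [map_powerSeries_inv _ (by simp)]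
    simp
  have h := sum_baileyBeta hX hq N
  convert h using 1
  · rw [map_sum]
    refine Finset.sum_congr rfl fun n _ => ?_
    rw [baileyTerm, map_mul, map_mul, map_mul, map_mul, map_powerSeries_inv _
      (by simp [constantCoeff_qPoch_X])]
    simp only [map_mul, map_pow, map_qPoch, baileyBeta]
    rw [div_eq_mul_inv]
  · rw [map_add, map_sum, map_sum]
    congr 1
    · refine Finset.sum_congr rfl fun n _ => ?_
      rw [map_mul, hinv, map_pow, div_eq_mul_inv]
    · refine Finset.sum_congr rfl fun r _ => ?_
      have h2 := hinv (2 * r + 1)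
      rw [show 2 * r + 1 + 1 = 2 * (r + 1) by ring] at h2
      simp only [map_mul, map_pow, map_qPoch, map_qPochInv_X, h2, baileyAlpha, map_add, map_neg,
        map_one, div_eq_mul_inv]

theorem X_pow_dvd_qPoch_sub {F : Type*} [Field F] {a b : ℕ} (h : a ≤ b) :
    (X : F⟦X⟧) ^ (a + 1) ∣ qPoch X b - qPoch X a := by
  induction b, h using Nat.le_induction with
  | base => simp
  | succ b hab ih =>
    rw [qPoch_succ, mul_sub, mul_one, sub_right_comm]
    exact dvd_sub ih (dvd_mul_of_dvd_right (pow_dvd_pow _ (by lia)) _)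

/-- The ratio is `1` up to order `N - 2(r+1) + 1`, and the power of `X` in front makes up the rest
because `(r+1)(r+2) ≥ 2(r+1)`. If `N < 2(r+1)` the ratio is `0` and that power alone suffices. -/
theorem X_pow_dvd_qPoch_ratio_sub_one (F : Type*) [Field F] (N r : ℕ) :
    (X : F⟦X⟧) ^ (N + 1) ∣ X ^ ((r + 1) * (r + 2)) *
      (qPoch X N ^ 2 * (qPochInv X (N - 2 * (r + 1)) * qPochInv X (N + 2 * (r + 1))) - 1) := by
  by_cases hr : N < 2 * (r + 1)
  · rw [qPochInv_of_neg _ (by lia)]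
    exact dvd_mul_of_dvd_left (pow_dvd_pow _ (by nlinarith)) _
  · obtain ⟨a, rfl⟩ := Nat.exists_eq_add_of_le (not_lt.1 hr)
    have e1 : ((2 * (r + 1) + a : ℕ) : ℤ) - 2 * (r + 1) = (a : ℕ) := by push_cast; ring
    have e2 : ((2 * (r + 1) + a : ℕ) : ℤ) + 2 * (r + 1) = ((4 * (r + 1) + a : ℕ) : ℤ) := by
      push_cast; ring
    rw [e1, e2, qPochInv_natCast, qPochInv_natCast]
    obtain ⟨u, hu⟩ := X_pow_dvd_qPoch_sub (F := F) (show a ≤ 2 * (r + 1) + a by lia)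
    obtain ⟨v, hv⟩ := X_pow_dvd_qPoch_sub (F := F) (show a ≤ 4 * (r + 1) + a by lia)
    have h1 := PowerSeries.mul_inv_cancel (qPoch (X : F⟦X⟧) a) (by simp [constantCoeff_qPoch_X])
    have h2 := PowerSeries.mul_inv_cancel (qPoch (X : F⟦X⟧) (4 * (r + 1) + a))
      (by simp [constantCoeff_qPoch_X])
    have h3 : (X : F⟦X⟧) ^ (a + 1) ∣ qPoch X (2 * (r + 1) + a) ^ 2 *
        ((qPoch X a)⁻¹ * (qPoch X (4 * (r + 1) + a))⁻¹) - 1 := by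
      rw [sub_eq_iff_eq_add] at hu hv
      rw [hu]
      generalize qPoch (X : F⟦X⟧) (4 * (r + 1) + a) = c at *
      generalize qPoch (X : F⟦X⟧) a = p at *
      refine ⟨(2 * u * p + X ^ (a + 1) * u ^ 2 - v * p) * (p⁻¹ * c⁻¹), ?_⟩
      rw [hv] at h2 ⊢
      linear_combination p * p⁻¹ * h2 + h1
    refine Dvd.dvd.trans ?_ (mul_dvd_mul_left (X ^ ((r + 1) * (r + 2))) h3)
    rw [← pow_add]
    exact pow_dvd_pow _ (by nlinarith)

/-- The left side counts `k = n · odd`, where `n` must be even; the right side counts `k = r · t`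
with `t > r` of opposite parity. Both are factorizations into factors of opposite parity, recorded
by the even factor or by the smaller one. -/
theorem card_odd_codivisors_eq_card_trapezoids {k N : ℕ} (hk : Even k) (hN : k ≤ N) :
    ((Finset.Icc 1 N).filter fun n => n ≤ k ∧ 2 * n ∣ k - n).card =
    ((Finset.Icc 1 N).filter fun r => r * (r + 1) ≤ k ∧ 2 * r ∣ k - r * (r + 1)).card := by
  have hA : ∀ n, n ∈ (Finset.Icc 1 N).filter (fun n => n ≤ k ∧ 2 * n ∣ k - n) ↔
      0 < n ∧ ∃ j, k = n * (2 * j + 1) := by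
    intro n
    rw [Finset.mem_filter, Finset.mem_Icc]
    constructor
    · rintro ⟨⟨h1, -⟩, h2, j, hj⟩
      exact ⟨h1, j, by rw [Nat.sub_eq_iff_eq_add h2] at hj; rw [hj]; ring⟩
    · rintro ⟨h1, j, rfl⟩
      have h2 : n ≤ n * (2 * j + 1) := Nat.le_mul_of_pos_right _ (by lia)
      exact ⟨⟨h1, h2.trans hN⟩, h2, j, by rw [Nat.sub_eq_iff_eq_add h2]; ring⟩
  have hB : ∀ r, r ∈ (Finset.Icc 1 N).filter
      (fun r => r * (r + 1) ≤ k ∧ 2 * r ∣ k - r * (r + 1)) ↔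
      0 < r ∧ ∃ j, k = r * (2 * j + r + 1) := by
    intro r
    rw [Finset.mem_filter, Finset.mem_Icc]
    constructor
    · rintro ⟨⟨h1, -⟩, h2, j, hj⟩
      exact ⟨h1, j, by rw [Nat.sub_eq_iff_eq_add h2] at hj; rw [hj]; ring⟩
    · rintro ⟨h1, j, rfl⟩
      have h2 : r * (r + 1) ≤ r * (2 * j + r + 1) := Nat.mul_le_mul_left _ (by lia)
      have h3 : r ≤ r * (2 * j + r + 1) := Nat.le_mul_of_pos_right _ (by lia)
      exact ⟨⟨h1, h3.trans hN⟩, h2, j, by rw [Nat.sub_eq_iff_eq_add h2]; ring⟩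
  refine Finset.card_nbij' (fun n => min n (k / n)) (fun r => if Odd r then k / r else r)
    ?_ ?_ ?_ ?_
  · intro n hn
    obtain ⟨h0, j, rfl⟩ := (hA n).1 hn
    refine (hB _).2 ?_
    have hn2 : Even n := by
      rcases Nat.even_mul.1 hk with h | h
      · exact h
      · exact absurd h (by simp)
    obtain ⟨t, rfl⟩ := hn2
    simp only [Nat.mul_div_cancel_left _ h0]
    rcases le_total (t + t) (2 * j + 1) with h | h
    · rw [min_eq_left h]
      exact ⟨h0, j - t, by congr 1; lia⟩
    · rw [min_eq_right h]
      refine ⟨by lia, t - j - 1, ?_⟩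
      rw [mul_comm]
      congr 1
      lia
  · intro r hr
    obtain ⟨h0, j, rfl⟩ := (hB r).1 hr
    refine (hA _).2 ?_
    simp only [Nat.mul_div_cancel_left _ h0]
    split_ifs with h
    · obtain ⟨t, rfl⟩ := h
      exact ⟨by lia, t, by ring⟩
    · obtain ⟨t, rfl⟩ := Nat.not_odd_iff_even.1 h
      exact ⟨h0, j + t, by congr 1; ring⟩
  · intro n hn
    obtain ⟨h0, j, rfl⟩ := (hA n).1 hn
    have hn2 : Even n := by
      rcases Nat.even_mul.1 hk with h | h
      · exact h
      · exact absurd h (by simp)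
    simp only [Nat.mul_div_cancel_left _ h0]
    rcases le_total n (2 * j + 1) with h | h
    · rw [min_eq_left h, if_neg (Nat.not_odd_iff_even.2 hn2)]
    · rw [min_eq_right h, if_pos (by simp), Nat.mul_div_cancel _ (by lia)]
  · intro r hr
    obtain ⟨h0, j, rfl⟩ := (hB r).1 hr
    simp only [Nat.mul_div_cancel_left _ h0]
    split_ifs with h
    · rw [Nat.mul_div_cancel _ (by lia), min_eq_right (by lia)]
    · rw [Nat.mul_div_cancel_left _ h0, min_eq_left (by lia)]

/-! ### Reduction modulo 2 and vanishing of even coefficients -/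

theorem one_sub_sq_zmod_two (f : (ZMod 2)⟦X⟧) : (1 - f) ^ 2 = 1 - f ^ 2 := by
  have h : (2 : (ZMod 2)⟦X⟧) = 0 := by
    rw [← map_ofNat (C (R := ZMod 2)) 2, show (OfNat.ofNat 2 : ZMod 2) = 0 from rfl, map_zero]
  linear_combination (f ^ 2 - f) * h

/-- The limiting form modulo `2` of the finite sums of `baileyTerm`. -/
noncomputable def baileyLimit (N : ℕ) : (ZMod 2)⟦X⟧ :=
  ∑ n ∈ Finset.Icc 1 N, X ^ n * (1 - X ^ (2 * n))⁻¹ +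
    ∑ r ∈ Finset.Icc 1 N, X ^ (r * (r + 1)) * (1 - X ^ (2 * r))⁻¹

theorem coeff_baileyLimit {k N : ℕ} (hk : Even k) (hN : k ≤ N) : coeff k (baileyLimit N) = 0 := by
  have h : ∀ e : ℕ → ℕ, coeff k (∑ n ∈ Finset.Icc 1 N,
      (X ^ e n * (1 - X ^ (2 * n))⁻¹ : (ZMod 2)⟦X⟧)) =
      (((Finset.Icc 1 N).filter fun n => e n ≤ k ∧ 2 * n ∣ k - e n).card : ℕ) := by
    intro e
    rw [map_sum, Finset.card_filter, Nat.cast_sum]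
    refine Finset.sum_congr rfl fun n hn => ?_
    rw [Finset.mem_Icc] at hn
    rw [coeff_X_pow_mul', coeff_inv_one_sub_X_pow (by lia)]
    by_cases h1 : e n ≤ k <;> simp [h1]
  rw [baileyLimit, map_add, h, h, card_odd_codivisors_eq_card_trapezoids hk hN]
  exact CharTwo.add_self_eq_zero _

theorem sum_range_succ_eq_sum_Icc {M : Type*} [AddCommMonoid M] (f : ℕ → M) (N : ℕ) :
    ∑ n ∈ Finset.range N, f (n + 1) = ∑ n ∈ Finset.Icc 1 N, f n := by
  rw [Finset.range_eq_Ico, Finset.sum_Ico_add' f 0 N 1]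
  rfl

theorem X_pow_dvd_sum_baileyTerm_sub (N : ℕ) :
    X ^ (N + 1) ∣ ∑ n ∈ Finset.range N, baileyTerm (ZMod 2) n - baileyLimit N := by
  rw [sum_baileyTerm, baileyLimit, ← sum_range_succ_eq_sum_Icc, ← sum_range_succ_eq_sum_Icc,
    add_sub_add_comm, ← Finset.sum_sub_distrib, ← Finset.sum_sub_distrib]
  refine dvd_add (Finset.dvd_sum fun n _ => ?_) (Finset.dvd_sum fun r _ => ?_)
  · rw [one_sub_sq_zmod_two, ← pow_mul, mul_comm (n + 1) 2, sub_self]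
    exact dvd_zero _
  · have h := X_pow_dvd_qPoch_ratio_sub_one (ZMod 2) N r
    generalize qPoch (X : (ZMod 2)⟦X⟧) N ^ 2 * (qPochInv X (N - 2 * (r + 1)) *
      qPochInv X (N + 2 * (r + 1))) = c at *
    have h2 : (-1 : (ZMod 2)⟦X⟧) = 1 := by
      rw [← map_one (C (R := ZMod 2)), ← map_neg, show (-1 : ZMod 2) = 1 from rfl]
    -- Modulo 2 the factor `1 + X^(2(r+1))` of `baileyAlpha` cancels one of the two denominators.
    have h3 : (1 : (ZMod 2)⟦X⟧) + X ^ (2 * (r + 1)) = 1 - X ^ (2 * (r + 1)) := by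
      linear_combination (-X ^ (2 * (r + 1))) * h2
    have h4 := PowerSeries.mul_inv_cancel (1 - X ^ (2 * (r + 1)) : (ZMod 2)⟦X⟧) (by simp)
    rw [baileyAlpha, h3, h2, one_pow, one_mul, pow_two (1 - _), PowerSeries.mul_inv_rev]
    generalize ((1 : (ZMod 2)⟦X⟧) - X ^ (2 * (r + 1))) = y at *
    have e : (X : (ZMod 2)⟦X⟧) ^ ((r + 1) * (r + 1 + 1)) =
      X ^ (r * (r + 1)) * X ^ (2 * (r + 1)) := by rw [← pow_add]; congr 1; ring
    have e' : X ^ (r * (r + 1)) * y * (X ^ (2 * (r + 1)) * (y⁻¹ * y⁻¹) * c) -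
        X ^ ((r + 1) * (r + 1 + 1)) * y⁻¹ = X ^ ((r + 1) * (r + 2)) * (c - 1) * y⁻¹ := by
      rw [show r + 2 = r + 1 + 1 from rfl, e]
      linear_combination (X ^ (r * (r + 1)) * X ^ (2 * (r + 1)) * y⁻¹ * c) * h4
    rw [e']
    exact dvd_mul_of_dvd_left h _

theorem coeff_inv_qPoch_X_sq_of_odd {F : Type*} [Field F] (M : ℕ) {k : ℕ} (hk : Odd k) :
    coeff k ((qPoch (X ^ 2 : F⟦X⟧) M)⁻¹) = 0 := by
  induction M generalizing k with
  | zero =>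
    rw [qPoch, Finset.prod_range_zero, PowerSeries.inv_eq_iff_mul_eq_one (by simp) |>.2 (one_mul 1),
      coeff_one, if_neg hk.pos.ne']
  | succ M ih =>
    rw [qPoch_succ, PowerSeries.mul_inv_rev, coeff_mul]
    refine Finset.sum_eq_zero fun p hp => ?_
    rw [Finset.HasAntidiagonal.mem_antidiagonal] at hp
    rcases Nat.even_or_odd p.2 with h | h
    · rw [← pow_mul, coeff_inv_one_sub_X_pow (by lia), if_neg, zero_mul]
      intro hd
      have h1 : Even p.1 := even_iff_two_dvd.2 ((dvd_mul_right _ _).trans hd)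
      exact Nat.not_even_iff_odd.2 hk (hp ▸ h1.add h)
    · rw [ih h, mul_zero]

theorem coeff_inv_mul_sum_baileyTerm {N : ℕ} (hN : Even N) (M : ℕ) :
    coeff N ((qPoch (X ^ 2) M)⁻¹ * ∑ n ∈ Finset.range N, baileyTerm (ZMod 2) n) = 0 := by
  obtain ⟨u, hu⟩ := X_pow_dvd_sum_baileyTerm_sub N
  rw [sub_eq_iff_eq_add] at hu
  rw [hu, mul_add, map_add, mul_left_comm, coeff_X_pow_mul', if_neg (by lia), zero_add, coeff_mul]
  refine Finset.sum_eq_zero fun p hp => ?_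
  rw [Finset.HasAntidiagonal.mem_antidiagonal] at hp
  rcases Nat.even_or_odd p.1 with h | h
  · rw [coeff_baileyLimit _ (by lia), mul_zero]
    rw [← hp, Nat.even_add] at hN
    exact hN.1 h
  · rw [coeff_inv_qPoch_X_sq_of_odd M h, zero_mul]

end PowerSeries

/-! ### Generating functions for a fixed smallest part -/

section GenFun

open PowerSeries

open scoped PowerSeries.WithPiTopology in
/-- A generating function whose character is supported on finitely many parts is a finite product. -/
theorem genFun_eq_prod {R : Type*} [CommRing R] (f : ℕ → ℕ → R) (A : Finset ℕ) (hA : 0 ∉ A)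
    (h0 : ∀ i ∈ A, f i 0 = 1) (hf : ∀ i ∉ A, ∀ c, f i c = 0) :
    Nat.Partition.genFun f =
      ∏ i ∈ A, PowerSeries.mk fun k => if i ∣ k then f i (k / i) else 0 := by
  -- The discrete topology gives meaning to the infinite product for `genFun`; uniqueness of its
  -- value then identifies it with the finite one.
  let _ : TopologicalSpace R := ⊥
  have _ : DiscreteTopology R := ⟨rfl⟩
  have hfac : ∀ i ∈ A, (1 : R⟦X⟧) + ∑' j, f i (j + 1) • X ^ (i * (j + 1)) =
      PowerSeries.mk fun k => if i ∣ k then f i (k / i) else 0 := by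
    intro i hi
    have hi0 : i ≠ 0 := fun h => hA (h ▸ hi)
    ext k
    rw [map_add, (Nat.Partition.summable_genFun_term' f hi0).map_tsum _
      (WithPiTopology.continuous_coeff _ _), coeff_mk, coeff_one]
    simp only [map_smul, coeff_X_pow, smul_eq_mul, mul_ite, mul_one, mul_zero]
    split_ifs with hk hd hd
    · subst hk
      rw [Nat.zero_div, h0 i hi]
      simp [hi0]
    · exact absurd (hk ▸ dvd_zero i) hd
    · obtain ⟨t, rfl⟩ := hd
      rw [Nat.mul_div_cancel_left _ (by lia), tsum_eq_single (t - 1)]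
      · have ht : t ≠ 0 := fun h => hk (by simp [h])
        rw [Nat.sub_add_cancel (by lia), if_pos rfl, zero_add]
      · intro j hj
        rw [if_neg]
        intro h
        have := Nat.eq_of_mul_eq_mul_left (by lia) h
        lia
    · rw [zero_add]
      convert tsum_zero with j
      rw [if_neg]
      rintro rfl
      exact hd (dvd_mul_right _ _)
  have hfac' : ∀ i ∉ A, (1 : R⟦X⟧) + ∑' j, f i (j + 1) • X ^ (i * (j + 1)) = 1 := by
    intro i hi
    simp [hf i hi]
  have h1 := Nat.Partition.hasProd_genFun f
  have h2 : HasProd (fun i => (1 : R⟦X⟧) + ∑' j, f (i + 1) (j + 1) • X ^ ((i + 1) * (j + 1)))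
      (∏ i ∈ A.image (· - 1), (1 + ∑' j, f (i + 1) (j + 1) • X ^ ((i + 1) * (j + 1)))) := by
    apply hasProd_prod_of_ne_finset_one
    intro i hi
    apply hfac'
    intro h
    exact hi (Finset.mem_image.2 ⟨i + 1, h, rfl⟩)
  rw [h1.unique h2, Finset.prod_image]
  · refine Finset.prod_congr rfl fun i hi => ?_
    have hi0 : i ≠ 0 := fun h => hA (h ▸ hi)
    rw [← hfac i hi, Nat.sub_add_cancel (by lia)]
  · intro i hi j hj h
    have hi0 : i ≠ 0 := fun h => hA (h ▸ hi)
    have hj0 : j ≠ 0 := fun h => hA (h ▸ hj)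
    simp only at h
    lia

/-- The parts greater than `s` and at most `2 * M`, without the odd parts greater than `2 * s`. -/
def largerParts (s M : ℕ) : Finset ℕ :=
  Finset.Ioc s (2 * s) ∪ (Finset.Ioc s M).image (2 * ·)

theorem mem_largerParts {s M i : ℕ} (hM : s ≤ M) :
    i ∈ largerParts s M ↔ s < i ∧ i ≤ 2 * M ∧ (Odd i → i ≤ 2 * s) := by
  simp only [largerParts, Finset.mem_union, Finset.mem_Ioc, Finset.mem_image]
  constructor
  · rintro (h | ⟨j, h, rfl⟩)
    · exact ⟨h.1, by lia, fun _ => h.2⟩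
    · exact ⟨by lia, by lia, fun ho => (Nat.not_odd_iff_even.2 (even_two_mul j) ho).elim⟩
  · rintro ⟨h1, h2, h3⟩
    rcases Nat.even_or_odd' i with ⟨j, rfl | rfl⟩
    · by_cases h : 2 * j ≤ 2 * s
      · exact Or.inl ⟨h1, h⟩
      · exact Or.inr ⟨j, by lia, rfl⟩
    · exact Or.inl ⟨h1, h3 (by simp)⟩

/-- The character of partitions into parts `s` and `largerParts s M` in which one further copy of
`s` may be marked. -/
def markedWeight (s M i c : ℕ) : ZMod 2 :=
  if i = s then c + 1 else if i ∈ largerParts s M then 1 else 0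

/-- The part `s` contributes `∑ (c+1) X^(sc) = 1/(1-X^s)²`, which is `1/(1-X^(2s))` modulo 2. -/
theorem genFun_markedWeight {s M : ℕ} (hs : s ≠ 0) (hM : s ≤ M) :
    Nat.Partition.genFun (markedWeight s M) = (1 - X ^ (2 * s))⁻¹ *
      ((∏ i ∈ Finset.Ioc s (2 * s), (1 - X ^ i)⁻¹) *
        ∏ j ∈ Finset.Ioc s M, (1 - (X ^ 2) ^ j)⁻¹) := by
  have hns : s ∉ largerParts s M := by simp [mem_largerParts hM]
  have h : ∀ i ∈ largerParts s M, (PowerSeries.mk fun k =>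
      if i ∣ k then markedWeight s M i (k / i) else 0) = (1 - X ^ i)⁻¹ := by
    intro i hi
    have hi0 := ((mem_largerParts hM).1 hi).1
    ext k
    rw [coeff_mk, coeff_inv_one_sub_X_pow (by lia), markedWeight, if_neg hi0.ne', if_pos hi]
  rw [genFun_eq_prod (markedWeight s M) (insert s (largerParts s M)), Finset.prod_insert hns,
    Finset.prod_congr rfl h, largerParts, Finset.prod_union, Finset.prod_image]
  · congr 1
    · ext k
      rw [coeff_mk, coeff_inv_one_sub_X_pow (by lia), markedWeight, if_pos rfl]
      by_cases hk : s ∣ k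
      · obtain ⟨t, rfl⟩ := hk
        have hd : 2 * s ∣ s * t ↔ 2 ∣ t := by
          rw [mul_comm 2 s, Nat.mul_dvd_mul_iff_left (by lia)]
        rw [if_pos (dvd_mul_right _ _), Nat.mul_div_cancel_left _ (by lia)]
        split_ifs with ht <;> rw [hd] at ht
        · rw [(ZMod.natCast_eq_zero_iff _ _).2 ht, zero_add]
        · rw [← Nat.cast_succ, ZMod.natCast_eq_zero_iff]
          lia
      · rw [if_neg hk, if_neg fun hd => hk ((dvd_mul_left _ _).trans hd)]
    · simp only [pow_mul]
  · intro i _ j _ hij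
    simpa using hij
  · rw [Finset.disjoint_left]
    intro i hi hi'
    rw [Finset.mem_Ioc] at hi
    obtain ⟨j, hj, rfl⟩ := Finset.mem_image.1 hi'
    rw [Finset.mem_Ioc] at hj
    lia
  · simp [mem_largerParts hM, hs.symm]
  · intro i hi
    rcases Finset.mem_insert.1 hi with rfl | hi
    · simp [markedWeight]
    · simp [markedWeight, hi]
  · intro i hi c
    rw [Finset.mem_insert, not_or] at hi
    rw [markedWeight, if_neg hi.1, if_neg hi.2]

theorem inv_qPoch_eq_mul_prod_Ioc {F : Type*} [Field F] (q : F⟦X⟧) {a b : ℕ} (h : a ≤ b) :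
    (qPoch q b)⁻¹ = (qPoch q a)⁻¹ * ∏ i ∈ Finset.Ioc a b, (1 - q ^ i)⁻¹ := by
  induction b, h using Nat.le_induction with
  | base => simp
  | succ b hab ih =>
    rw [qPoch_succ, PowerSeries.mul_inv_rev, Finset.prod_Ioc_succ_top (by lia), ih]
    ring

/-- Splitting `1/(q²; q²)_M` and `1/(q; q)_{2n+2}` at `n + 1` exposes the two products over larger
parts; the rest cancels to `1/(1-q^(n+1))²`. -/
theorem X_pow_mul_genFun_markedWeight {n M : ℕ} (hM : n + 1 ≤ M) :
    X ^ (n + 1).choose 2 * (X ^ (n + 1) * Nat.Partition.genFun (markedWeight (n + 1) M)) =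
      (qPoch (X ^ 2) M)⁻¹ * baileyTerm (ZMod 2) n := by
  rw [genFun_markedWeight (by lia) hM, baileyTerm, inv_qPoch_eq_mul_prod_Ioc _ hM,
    PowerSeries.mul_inv_rev,
    inv_qPoch_eq_mul_prod_Ioc _ (show n + 1 ≤ 2 * (n + 1) by lia), mul_comm 2 (n + 1), pow_mul,
    ← one_sub_sq_zmod_two, pow_two (1 - _), PowerSeries.mul_inv_rev, qPoch_succ X n,
    PowerSeries.mul_inv_rev (qPoch X n)]
  have h1 := PowerSeries.mul_inv_cancel (qPoch (X : (ZMod 2)⟦X⟧) n)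
    (by simp [constantCoeff_qPoch_X])
  have h2 := PowerSeries.mul_inv_cancel (qPoch (X ^ 2 : (ZMod 2)⟦X⟧) (n + 1))
    (by simp [constantCoeff_qPoch])
  generalize (∏ i ∈ Finset.Ioc (n + 1) ((n + 1) * 2), (1 - X ^ i : (ZMod 2)⟦X⟧)⁻¹) = U
  generalize (∏ i ∈ Finset.Ioc (n + 1) M, (1 - (X ^ 2) ^ i : (ZMod 2)⟦X⟧)⁻¹) = V
  generalize (1 - X ^ (n + 1) : (ZMod 2)⟦X⟧)⁻¹ = y
  generalize (qPoch (X ^ 2 : (ZMod 2)⟦X⟧) (n + 1))⁻¹ = d' at *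
  generalize qPoch (X ^ 2 : (ZMod 2)⟦X⟧) (n + 1) = d at *
  generalize (qPoch (X : (ZMod 2)⟦X⟧) n)⁻¹ = p' at *
  generalize qPoch (X : (ZMod 2)⟦X⟧) n = p at *
  have h3 : p ^ 2 * p' ^ 2 = 1 := by rw [← mul_pow, h1, one_pow]
  linear_combination (-X ^ (n + 1).choose 2 * X ^ (n + 1) * y ^ 2 * U * V) *
    (p ^ 2 * p' ^ 2 * h2 + h3)

end GenFun

/-! ### Partitions sorted by smallest part -/

section SmallestPart

theorem smallestPart_eq_iff {m s : ℕ} (π : m.Partition) (hs : s ≠ 0) :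
    smallestPart π = s ↔ s ∈ π.parts ∧ ∀ i ∈ π.parts, s ≤ i := by
  unfold smallestPart
  constructor
  · intro h
    cases hm : π.parts.toFinset.min with
    | top => rw [hm] at h; exact absurd h.symm hs
    | coe t =>
      rw [hm, WithTop.untopD_coe] at h
      subst h
      exact ⟨Multiset.mem_toFinset.1 (Finset.mem_of_min hm),
        fun i hi => Finset.min_le_of_eq (Multiset.mem_toFinset.2 hi) hm⟩
  · rintro ⟨h1, h2⟩
    have h : π.parts.toFinset.min = (s : WithTop ℕ) := by
      refine le_antisymm (Finset.min_le (Multiset.mem_toFinset.2 h1)) (Finset.le_min ?_)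
      intro i hi
      exact WithTop.coe_le_coe.2 (h2 i (Multiset.mem_toFinset.1 hi))
    rw [h]
    rfl

theorem count_smallestPart_zero {m : ℕ} (π : m.Partition) (h : smallestPart π = 0) :
    π.parts.count (smallestPart π) = 0 := by
  rw [h, Multiset.count_eq_zero]
  exact fun h0 => (π.parts_pos h0).ne' rfl

/-- Adding a part `s` to a partition. -/
def consPart {b s : ℕ} (hs : s ≠ 0) (σ : b.Partition) : (b + s).Partition where
  parts := s ::ₘ σ.parts
  parts_pos := by
    intro i hi
    rcases Multiset.mem_cons.1 hi with rfl | hi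
    · exact Nat.pos_of_ne_zero hs
    · exact σ.parts_pos hi
  parts_sum := by rw [Multiset.sum_cons, σ.parts_sum, add_comm]

theorem consPart_injective {b s : ℕ} (hs : s ≠ 0) :
    Function.Injective (consPart hs : b.Partition → (b + s).Partition) := by
  intro σ τ h
  have := congrArg Nat.Partition.parts h
  exact Nat.Partition.ext ((Multiset.cons_inj_right s).1 this)

theorem exists_consPart_eq {b s : ℕ} (hs : s ≠ 0) (π : (b + s).Partition) (h : s ∈ π.parts) :
    ∃ σ : b.Partition, consPart hs σ = π := by
  obtain ⟨t, ht⟩ := Multiset.exists_cons_of_mem h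
  have h1 := π.parts_sum
  rw [ht, Multiset.sum_cons] at h1
  exact ⟨⟨t, fun hi => π.parts_pos (ht ▸ Multiset.mem_cons_of_mem hi), by lia⟩,
    Nat.Partition.ext ht.symm⟩

/-- The contribution modulo `2` of the partitions of `a` with smallest part `s`. -/
def sptWithSmallest (s a : ℕ) : ZMod 2 :=
  ∑ π : a.Partition, if smallestPart π = s ∧ NoLargeOddParts π then (π.parts.count s : ZMod 2) else 0

/-- Removing one obligatory copy of `s` leaves `c` copies, whence the weight `c + 1`. The bound `b ≤
2 * M` ensures that truncating `largerParts` loses no part. -/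
theorem prod_markedWeight {b s M : ℕ} (hs : s ≠ 0) (hM : s ≤ M) (hb : b ≤ 2 * M)
    (σ : b.Partition) :
    σ.parts.toFinsupp.prod (markedWeight s M) =
      if smallestPart (consPart hs σ) = s ∧ NoLargeOddParts (consPart hs σ) then
        ((consPart hs σ).parts.count s : ZMod 2) else 0 := by
  have key : (smallestPart (consPart hs σ) = s ∧ NoLargeOddParts (consPart hs σ)) ↔
      ∀ i ∈ σ.parts, i ≠ s → i ∈ largerParts s M := by
    constructor
    · rintro ⟨h1, h2⟩ i hi his
      rw [NoLargeOddParts, h1] at h2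
      have h3 := ((smallestPart_eq_iff _ hs).1 h1).2 i (Multiset.mem_cons_of_mem hi)
      exact (mem_largerParts hM).2 ⟨by lia, (Nat.Partition.le_of_mem_parts hi).trans hb,
        h2 i (Multiset.mem_cons_of_mem hi)⟩
    · intro h
      have h1 : smallestPart (consPart hs σ) = s := by
        refine (smallestPart_eq_iff _ hs).2 ⟨Multiset.mem_cons_self _ _, fun i hi => ?_⟩
        rcases Multiset.mem_cons.1 hi with rfl | hi
        · exact le_rfl
        · by_cases his : i = s
          · exact his.ge
          · exact ((mem_largerParts hM).1 (h i hi his)).1.le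
      refine ⟨h1, fun i hi ho => ?_⟩
      rw [h1]
      rcases Multiset.mem_cons.1 hi with rfl | hi
      · lia
      · by_cases his : i = s
        · lia
        · exact ((mem_largerParts hM).1 (h i hi his)).2.2 ho
  have hcount : ((consPart hs σ).parts.count s : ZMod 2) = σ.parts.count s + 1 := by
    simp [consPart]
  rw [Finsupp.prod, Multiset.toFinsupp_support]
  simp only [Multiset.toFinsupp_apply]
  rw [hcount]
  split_ifs with h
  · rw [key] at h
    by_cases hmem : s ∈ σ.parts
    · rw [Finset.prod_eq_single s]
      · simp [markedWeight]
      · intro i hi his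
        rw [markedWeight, if_neg his, if_pos (h i (Multiset.mem_toFinset.1 hi) his)]
      · intro h'
        exact absurd (Multiset.mem_toFinset.2 hmem) h'
    -- Here `s` is outside the support, and the empty contribution `1` agrees with `c + 1` at `c =
    -- 0`.
    · rw [Multiset.count_eq_zero_of_notMem hmem, Finset.prod_eq_one]
      · simp
      · intro i hi
        rw [Multiset.mem_toFinset] at hi
        have his : i ≠ s := fun e => hmem (e ▸ hi)
        rw [markedWeight, if_neg his, if_pos (h i hi his)]
  · rw [key] at h
    push Not at h
    obtain ⟨i, hi, his, hA⟩ := h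
    refine Finset.prod_eq_zero (Multiset.mem_toFinset.2 hi) ?_
    rw [markedWeight, if_neg his, if_neg hA]

open PowerSeries in
theorem sptWithSmallest_eq_coeff {a s M : ℕ} (hs : s ≠ 0) (hM : s ≤ M) (ha : a ≤ 2 * M) :
    sptWithSmallest s a = coeff a (X ^ s * Nat.Partition.genFun (markedWeight s M)) := by
  rw [coeff_X_pow_mul']
  split_ifs with h
  · obtain ⟨b, rfl⟩ := Nat.exists_eq_add_of_le' h
    rw [Nat.add_sub_cancel, Nat.Partition.coeff_genFun]
    refine (Finset.sum_of_injOn (consPart hs) (consPart_injective hs).injOn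
      (fun _ _ => Finset.mem_coe.2 (Finset.mem_univ _)) ?_ ?_).symm
    · intro π _ hπ
      rw [if_neg]
      rintro ⟨h1, -⟩
      obtain ⟨σ, hσ⟩ := exists_consPart_eq hs π ((smallestPart_eq_iff _ hs).1 h1).1
      exact hπ ⟨σ, Finset.mem_coe.2 (Finset.mem_univ _), hσ⟩
    · intro σ _
      exact prod_markedWeight hs hM (by lia) σ
  · refine Finset.sum_eq_zero fun π _ => ?_
    rw [if_neg]
    rintro ⟨h1, -⟩
    exact h (Nat.Partition.le_of_mem_parts ((smallestPart_eq_iff _ hs).1 h1).1)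

theorem sum_triangularParts (l : ℕ) : (triangularParts l).sum = l.choose 2 := by
  rw [Nat.choose_two_right, ← Finset.sum_range_id, triangularParts, Finset.sum_val]
  cases l with
  | zero => rfl
  | succ l => rw [Finset.sum_range_eq_add_Ico _ (Nat.succ_pos l)]; simp

theorem sum_partition_parts_eq_ite {M : Type*} [AddCommMonoid M] (l b : ℕ) (x : M) :
    ∑ σ : b.Partition, (if σ.parts = triangularParts l then x else 0) =
      if l.choose 2 = b then x else 0 := by
  split_ifs with h
  · let τ : b.Partition := ⟨triangularParts l, fun {i} hi =>
      (Finset.mem_Ico.1 (show i ∈ Finset.Ico 1 l from hi)).1, by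
      rw [sum_triangularParts, h]⟩
    rw [Finset.sum_eq_single τ]
    · exact if_pos rfl
    · intro σ _ hσ
      exact if_neg fun e => hσ (Nat.Partition.ext e)
    · intro h'
      exact absurd (Finset.mem_univ _) h'
  · refine Finset.sum_eq_zero fun σ _ => if_neg fun e => h ?_
    rw [← sum_triangularParts, ← e, σ.parts_sum]

theorem natCast_sptOMinus (m : ℕ) :
    (sptOMinus m : ZMod 2) = ∑ s ∈ Finset.Icc 1 m, ∑ p ∈ Finset.HasAntidiagonal.antidiagonal m,
      if s.choose 2 = p.2 then sptWithSmallest s p.1 else 0 := by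
  rw [sptOMinus, Nat.cast_sum, Finset.sum_comm]
  refine Finset.sum_congr rfl fun p hp => ?_
  rw [Finset.HasAntidiagonal.mem_antidiagonal] at hp
  rw [Nat.cast_sum, Finset.sum_filter, Fintype.sum_prod_type]
  have h1 : ∀ π : p.1.Partition, (∑ σ : p.2.Partition,
      if σ.parts = triangularParts (smallestPart π) ∧ NoLargeOddParts π then
        (π.parts.count (smallestPart π) : ZMod 2) else 0) =
      ∑ s ∈ Finset.Icc 1 m, if s.choose 2 = p.2 then
        (if smallestPart π = s ∧ NoLargeOddParts π then (π.parts.count s : ZMod 2) else 0)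
        else 0 := by
    intro π
    simp only [ite_and]
    rw [sum_partition_parts_eq_ite]
    by_cases h0 : smallestPart π = 0
    · rw [count_smallestPart_zero π h0, Finset.sum_eq_zero]
      · simp
      · intro s hs
        rw [Finset.mem_Icc] at hs
        rw [if_neg (show ¬smallestPart π = s by lia), ite_self]
    · rw [Finset.sum_eq_single (smallestPart π)]
      · simp
      · intro s _ hs
        rw [if_neg (Ne.symm hs), ite_self]
      · intro h
        have h2 := Nat.Partition.le_of_mem_parts ((smallestPart_eq_iff π h0).1 rfl).1
        exact absurd (Finset.mem_Icc.2 ⟨by lia, by lia⟩) h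
  rw [Finset.sum_congr rfl fun π _ => h1 π, Finset.sum_comm]
  refine Finset.sum_congr rfl fun s _ => ?_
  split_ifs
  · rfl
  · exact Finset.sum_const_zero

open PowerSeries in
theorem natCast_sptOMinus_eq_coeff (m : ℕ) :
    (sptOMinus m : ZMod 2) =
      coeff m ((qPoch (X ^ 2) m)⁻¹ * ∑ n ∈ Finset.range m, baileyTerm (ZMod 2) n) := by
  rw [natCast_sptOMinus, ← sum_range_succ_eq_sum_Icc, Finset.mul_sum, map_sum]
  refine Finset.sum_congr rfl fun n hn => ?_
  rw [Finset.mem_range] at hn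
  rw [← X_pow_mul_genFun_markedWeight hn, mul_comm (X ^ _), coeff_mul]
  refine Finset.sum_congr rfl fun p hp => ?_
  rw [Finset.HasAntidiagonal.mem_antidiagonal] at hp
  rw [coeff_X_pow, mul_ite, mul_one, mul_zero,
    sptWithSmallest_eq_coeff (Nat.succ_ne_zero n) hn (by lia)]
  simp only [eq_comm]

end SmallestPart

theorem theorem4 (n : ℕ) : Even (sptOMinus (2 * n)) := by
  rw [← ZMod.natCast_eq_zero_iff_even, natCast_sptOMinus_eq_coeff]
  exact coeff_inv_mul_sum_baileyTerm (even_two_mul n) _
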